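/- Let $G=(V,E)$ be a connected finite simple graph. A routing $R$ in $G$ is a set of paths of $G$ containing, for each unordered pair of distinct vertices of $G$, exactly one path with these two vertices as its terminal vertices (and no other paths). Its conflict graph $Q(R)$ is the graph with vertex set $R$ in which two distinct paths are adjacent if and only if they have a common edge. The undirected optical index of $G$ is $w(G)=\min_R \chi(Q(R))$, where $R$ runs over all routings in $G$ and $\chi$ denotes the chromatic number. For integers $m,h\ge 1$ let $T_{m,h}$ be the complete $m$-ary tree of height $h$: its vertices are the words of length at most $h$ over an alphabet of $m$ letters, and each word of length less than $h$ is joined by an edge to the $m$ words obtained by appending one letter to it (its children). **Theorem.** (i) For all $h\ge 1$, $w(T_{1,h})=\left\lfloor\frac{h+1}{2}\right\rfloor\left\lceil\frac{h+1}{2}\right\rceil$. (ii) $w(T_{2,1})=2$, $w(T_{2,2})=12$, and $w(T_{2,h})=5\cdot 2^{2h-2}-3\cdot 2^h+1$ for all $h\ge 3$. (iii) If $m\ge 3$ is odd and $h\ge 1$, then $w(T_{m,h})=m\,(1+m+m^2+\cdots+m^{h-1})^2$. (iv) If $m\ge 4$ is even and $h\ge 1$, then $w(T_{m,h})=m^h\,(1+m+m^2+\cdots+m^{h-1})$.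 -/

import Mathlib

namespace OpticalIndex

/-- `P` is (the edge set of) a path of `G` with terminal vertices `u` and `v`.
A path of positive length is determined, up to reversal, by its set of edges. -/
def IsPathBetween {V : Type*} (G : SimpleGraph V) (u v : V) (P : Set (Sym2 V)) : Prop :=
  ∃ p : G.Walk u v, p.IsPath ∧ P = p.edgeSet

/-- An (undirected) all-to-all routing in `G`: a set of paths with distinct terminal vertices
that contains exactly one path for each unordered pair of distinct vertices. -/
structure IsRouting {V : Type*} (G : SimpleGraph V) (R : Set (Set (Sym2 V))) : Prop where
  isPath : ∀ P ∈ R, ∃ u v : V, u ≠ v ∧ IsPathBetween G u v P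
  existsUnique : ∀ u v : V, u ≠ v → ∃! P, P ∈ R ∧ IsPathBetween G u v P

/-- The conflict graph `Q(R)`: its vertices are the paths in `R`, and two different paths are
adjacent iff they have a common edge. -/
def conflictGraph {V : Type*} (R : Set (Set (Sym2 V))) : SimpleGraph R where
  Adj P P' := P ≠ P' ∧ ∃ e : Sym2 V, e ∈ P.1 ∧ e ∈ P'.1
  symm := ⟨fun _ _ h => ⟨h.1.symm, h.2.imp fun _ he => he.symm⟩⟩
  loopless := ⟨fun _ h => h.1 rfl⟩

/-- The undirected optical index `w(G)`: the minimum of the chromatic number of `Q(R)` over all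
routings `R` in `G` (`⊤` if there is no routing, or no finite chromatic number). -/
noncomputable def opticalIndex {V : Type*} (G : SimpleGraph V) : ℕ∞ :=
  ⨅ (R : Set (Set (Sym2 V))) (_ : IsRouting G R), (conflictGraph R).chromaticNumber

/-- The vertices of the complete `m`-ary tree of height `h`: words of length at most `h` in
`m` letters. The empty word is the root; words of length `k` form the `k`-th layer. -/
abbrev TreeVertex (m h : ℕ) : Type := {w : List (Fin m) // w.length ≤ h}

/-- `v` is a child of `u`: the word `v` is `u` followed by one more letter. -/
def IsChild {m h : ℕ} (u v : TreeVertex m h) : Prop :=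
  ∃ t : Fin m, v.1 = u.1 ++ [t]

/-- The complete `m`-ary tree `T_{m,h}` of height `h`: each vertex is joined to its children. -/
def completeTree (m h : ℕ) : SimpleGraph (TreeVertex m h) where
  Adj u v := IsChild u v ∨ IsChild v u
  symm := ⟨fun _ _ h => h.symm⟩
  loopless := ⟨fun u h => by
    rcases h with ⟨t, ht⟩ | ⟨t, ht⟩ <;> simp at ht⟩

end OpticalIndex

/-! A tree has one path for each pair of vertices, hence one routing, and the task is to colour
`pairGraph`, where two pairs conflict when some edge separates both.

Three obstructions give the lower bounds. The paths through one edge form a clique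
(`card_cut_le_of_colorable`); the best choice is an edge at the root for `m ≥ 2` and a middle edge
for `m = 1`. For `m = 2`, a vertex `z` of depth one that is not a leaf has three edges, and every
path with `z` in its interior uses two of them, so these paths form a clique
(`card_star_le_of_colorable`), which beats the cut bound from height 3 on. For odd `m ≥ 3`, a colour
class contains at most `(m - 1) / 2` paths joining different branches of the root
(`mul_sq_le_of_colorable`).

For the upper bounds, the paths joining different branches of the root are coloured explicitly: a
proper edge colouring of the complete graph on the branches is combined with the positions of the
two ends inside their branches. The other paths are coloured greedily from the root downwards
(`colorable_of_rank`), and the conflicts met at each moment lie in a single `cut` or `star`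
(`pairGraph_colorable`). Comparing the sizes shows that the obstructions are the only ones; for `m ≥
3` the stars are too small to matter (`star_count_le`). -/

namespace OpticalIndex

variable {m h : ℕ}

/-! ### Paths of the tree described by the edges separating their ends -/

/-- The pair `q` is separated by the edge above `c`: exactly one of its members lies in the
subtree rooted at `c`. -/
def Crosses (c : TreeVertex m h) (q : Sym2 (TreeVertex m h)) : Prop :=
  ∃ x y, q = s(x, y) ∧ c.1 <+: x.1 ∧ ¬ c.1 <+: y.1

/-- The parent of a vertex (the root is its own parent). -/
def parent (c : TreeVertex m h) : TreeVertex m h :=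
  ⟨c.1.dropLast, by have := c.2; simp; omega⟩

/-- The edge joining `c` to its parent. -/
def upEdge (c : TreeVertex m h) : Sym2 (TreeVertex m h) := s(parent c, c)

theorem crosses_mk {c x y : TreeVertex m h} :
    Crosses c s(x, y) ↔ (c.1 <+: x.1 ∧ ¬ c.1 <+: y.1) ∨ (c.1 <+: y.1 ∧ ¬ c.1 <+: x.1) := by
  constructor
  · rintro ⟨a, b, hq, ha, hb⟩
    rcases Sym2.eq_iff.1 hq with ⟨rfl, rfl⟩ | ⟨rfl, rfl⟩
    · exact Or.inl ⟨ha, hb⟩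
    · exact Or.inr ⟨ha, hb⟩
  · rintro (⟨h1, h2⟩ | ⟨h1, h2⟩)
    · exact ⟨x, y, rfl, h1, h2⟩
    · exact ⟨y, x, Sym2.eq_swap, h1, h2⟩

theorem Crosses.ne_nil {c : TreeVertex m h} {q : Sym2 (TreeVertex m h)} (hc : Crosses c q) :
    c.1 ≠ [] := by
  rintro h0
  obtain ⟨x, y, -, -, hy⟩ := hc
  exact hy (by simp [h0])

theorem parent_of_isChild {u v : TreeVertex m h} (huv : IsChild u v) : parent v = u := by
  obtain ⟨t, ht⟩ := huv
  apply Subtype.ext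
  simp [parent, ht]

theorem isChild_parent {c : TreeVertex m h} (hc : c.1 ≠ []) : IsChild (parent c) c :=
  ⟨c.1.getLast hc, (List.dropLast_append_getLast hc).symm⟩

theorem IsChild.length_eq {u v : TreeVertex m h} (huv : IsChild u v) :
    v.1.length = u.1.length + 1 := by
  obtain ⟨t, ht⟩ := huv
  simp [ht]

theorem IsChild.ne_nil {u v : TreeVertex m h} (huv : IsChild u v) : v.1 ≠ [] := by
  obtain ⟨t, ht⟩ := huv
  simp [ht]

theorem upEdge_injective {c d : TreeVertex m h} (hc : c.1 ≠ []) (hd : d.1 ≠ [])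
    (hcd : upEdge c = upEdge d) : c = d := by
  rcases Sym2.eq_iff.1 hcd with ⟨-, h2⟩ | ⟨h1, h2⟩
  · exact h2
  · have hc' := (isChild_parent hc).length_eq
    have hd' := (isChild_parent hd).length_eq
    rw [h1] at hc'
    rw [← h2] at hd'
    omega

theorem crosses_iff_eq_upEdge_of_isChild {c u v : TreeVertex m h} (huv : IsChild u v)
    (hc : c.1 ≠ []) : Crosses c s(u, v) ↔ upEdge c = s(u, v) := by
  have hv := huv.ne_nil
  have key : Crosses c s(u, v) ↔ c = v := by
    have hl := huv.length_eq
    obtain ⟨t, ht⟩ := huv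
    have e : c = v ↔ c.1 = v.1 := Subtype.ext_iff
    have h1 : c.1 <+: v.1 ↔ c.1 = v.1 ∨ c.1 <+: u.1 := by
      rw [ht]; exact List.prefix_concat_iff
    rw [crosses_mk, h1, e]
    constructor
    · tauto
    · intro h2
      refine Or.inr ⟨Or.inl h2, fun h3 => ?_⟩
      have := h3.length_le
      rw [h2] at this
      omega
  rw [key]
  have e : s(u, v) = upEdge v := by rw [upEdge, parent_of_isChild huv]
  rw [e]
  exact ⟨fun h => by rw [h], upEdge_injective hc hv⟩

theorem crosses_iff_eq_upEdge {c u v : TreeVertex m h} (huv : (completeTree m h).Adj u v)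
    (hc : c.1 ≠ []) : Crosses c s(u, v) ↔ upEdge c = s(u, v) := by
  rcases huv with huv | huv
  · exact crosses_iff_eq_upEdge_of_isChild huv hc
  · rw [Sym2.eq_swap]
    exact crosses_iff_eq_upEdge_of_isChild huv hc

/-- A step of the walk changes sides of the cut exactly when it runs along `upEdge c`, so the parity
of the number of such steps tells whether the two ends lie on different sides. -/
theorem crosses_iff_odd_count {c : TreeVertex m h} (hc : c.1 ≠ []) {u v : TreeVertex m h}
    (p : (completeTree m h).Walk u v) :
    Crosses c s(u, v) ↔ Odd (p.edges.count (upEdge c)) := by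
  induction p with
  | nil => simp [crosses_mk]
  | @cons u v w huv p ih =>
    have h1 := crosses_iff_eq_upEdge huv hc
    rw [SimpleGraph.Walk.edges_cons, List.count_cons]
    by_cases he : upEdge c = s(u, v)
    · have h2 := h1.2 he
      simp only [he, beq_self_eq_true, if_true, Nat.odd_add_one]
      rw [he] at ih
      rw [← ih]
      clear ih
      rw [crosses_mk] at *
      rw [crosses_mk]
      tauto
    · have h2 := mt h1.1 he
      have he' : (s(u, v) == upEdge c) = false := by simpa using Ne.symm he
      simp only [he', Bool.false_eq_true, if_false, add_zero]
      rw [← ih]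
      clear ih
      rw [crosses_mk] at *
      rw [crosses_mk]
      tauto

/-- A path uses each edge at most once, so an odd count means membership. This gives uniqueness of
paths without a separate proof of acyclicity. -/
theorem mem_edges_iff {u v : TreeVertex m h} {p : (completeTree m h).Walk u v} (hp : p.IsPath)
    (e : Sym2 (TreeVertex m h)) :
    e ∈ p.edges ↔ ∃ c, Crosses c s(u, v) ∧ e = upEdge c := by
  have key : ∀ c : TreeVertex m h, c.1 ≠ [] → (Crosses c s(u, v) ↔ upEdge c ∈ p.edges) := by
    intro c hc
    have h1 : p.edges.count (upEdge c) ≤ 1 :=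
      List.nodup_iff_count_le_one.1 hp.isTrail.edges_nodup _
    rw [crosses_iff_odd_count hc p, ← List.count_pos_iff]
    constructor
    · exact fun h => h.pos
    · intro h2
      have : p.edges.count (upEdge c) = 1 := by omega
      rw [this]; exact odd_one
  constructor
  · intro he
    have hG := p.edges_subset_edgeSet he
    have : ∃ c : TreeVertex m h, c.1 ≠ [] ∧ e = upEdge c := by
      induction e with
      | _ a b =>
        rcases (hG : IsChild a b ∨ IsChild b a) with hab | hab
        · refine ⟨b, ?_, ?_⟩
          · exact hab.ne_nil
          · rw [upEdge, parent_of_isChild hab]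
        · refine ⟨a, ?_, ?_⟩
          · exact hab.ne_nil
          · rw [upEdge, parent_of_isChild hab, Sym2.eq_swap]
    obtain ⟨c, hc, rfl⟩ := this
    exact ⟨c, (key c hc).2 he, rfl⟩
  · rintro ⟨c, hc, rfl⟩
    exact (key c hc.ne_nil).1 hc

theorem reachable_root (u : TreeVertex m h) :
    (completeTree m h).Reachable ⟨[], by simp⟩ u := by
  obtain ⟨l, hl⟩ := u
  induction l using List.reverseRecOn with
  | nil => exact SimpleGraph.Reachable.refl _
  | append_singleton l t ih =>
    have hl' : l.length ≤ h := by simp at hl; omega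
    exact (ih hl').trans (SimpleGraph.Adj.reachable (Or.inl ⟨t, rfl⟩))

/-- The edge set of the path joining the members of `q`. -/
def pathEdges (q : Sym2 (TreeVertex m h)) : Set (Sym2 (TreeVertex m h)) :=
  {e | ∃ c, Crosses c q ∧ e = upEdge c}

theorem isPathBetween_iff {u v : TreeVertex m h} {P : Set (Sym2 (TreeVertex m h))} :
    IsPathBetween (completeTree m h) u v P ↔ P = pathEdges s(u, v) := by
  constructor
  · rintro ⟨p, hp, rfl⟩
    ext e
    exact mem_edges_iff hp e
  · rintro rfl
    obtain ⟨p, hp⟩ := ((reachable_root u).symm.trans (reachable_root v)).exists_isPath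
    refine ⟨p, hp, ?_⟩
    ext e
    exact (mem_edges_iff hp e).symm

theorem upEdge_mem_pathEdges {c : TreeVertex m h} (hc : c.1 ≠ []) {q : Sym2 (TreeVertex m h)} :
    upEdge c ∈ pathEdges q ↔ Crosses c q := by
  constructor
  · rintro ⟨d, hd, hcd⟩
    rwa [upEdge_injective hc hd.ne_nil hcd]
  · exact fun h => ⟨c, h, rfl⟩

/-- The edge above the deepest end `u` separates the pair; the other pair then has an end below `u`,
which by length is `u` itself. With `u` cancelled, the remaining ends have the same prefixes. This
serves to show that different pairs span different edge sets. -/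
theorem eq_of_crosses_iff_of_longest {u v x y : TreeVertex m h} (huv : u ≠ v)
    (hv : v.1.length ≤ u.1.length) (hx : x.1.length ≤ u.1.length)
    (hy : y.1.length ≤ u.1.length)
    (H : ∀ c, Crosses c s(u, v) ↔ Crosses c s(x, y)) : s(u, v) = s(x, y) := by
  have main : ∀ z : TreeVertex m h, (∀ c, Crosses c s(u, v) ↔ Crosses c s(u, z)) → v = z := by
    intro z hz
    have hp : ∀ c : TreeVertex m h, c.1 <+: v.1 ↔ c.1 <+: z.1 := by
      intro c
      have := hz c
      rw [crosses_mk, crosses_mk] at this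
      tauto
    have h1 := (hp v).1 List.prefix_rfl
    have h2 := (hp z).2 List.prefix_rfl
    exact Subtype.ext (h1.eq_of_length (le_antisymm h1.length_le h2.length_le))
  have hu : Crosses u s(u, v) := crosses_mk.2 (Or.inl ⟨List.prefix_rfl, fun hp =>
    huv (Subtype.ext (hp.eq_of_length (le_antisymm hp.length_le hv)))⟩)
  rcases crosses_mk.1 ((H u).1 hu) with ⟨hp, -⟩ | ⟨hp, -⟩
  · obtain rfl : u = x := Subtype.ext (hp.eq_of_length (le_antisymm hp.length_le hx))
    rw [main y H]
  · obtain rfl : u = y := Subtype.ext (hp.eq_of_length (le_antisymm hp.length_le hy))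
    rw [Sym2.eq_swap (a := x)] at H ⊢
    rw [main x H]

theorem eq_of_crosses_iff {q r : Sym2 (TreeVertex m h)} (hq : ¬ q.IsDiag) (hr : ¬ r.IsDiag)
    (H : ∀ c, Crosses c q ↔ Crosses c r) : q = r := by
  induction q with
  | _ u v =>
  induction r with
  | _ x y =>
  rw [Sym2.mk_isDiag_iff] at hq hr
  have H' := fun c => (H c).symm
  by_cases h1 : v.1.length ≤ u.1.length ∧ x.1.length ≤ u.1.length ∧ y.1.length ≤ u.1.length
  · exact eq_of_crosses_iff_of_longest hq h1.1 h1.2.1 h1.2.2 H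
  by_cases h2 : u.1.length ≤ v.1.length ∧ x.1.length ≤ v.1.length ∧ y.1.length ≤ v.1.length
  · rw [Sym2.eq_swap] at H ⊢
    exact eq_of_crosses_iff_of_longest (Ne.symm hq) h2.1 h2.2.1 h2.2.2 H
  by_cases h3 : y.1.length ≤ x.1.length ∧ u.1.length ≤ x.1.length ∧ v.1.length ≤ x.1.length
  · exact (eq_of_crosses_iff_of_longest hr h3.1 h3.2.1 h3.2.2 H').symm
  · rw [Sym2.eq_swap (a := x)] at H' ⊢
    exact (eq_of_crosses_iff_of_longest (Ne.symm hr) (by omega) (by omega) (by omega) H').symm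

theorem Crosses.not_isDiag {c : TreeVertex m h} {q : Sym2 (TreeVertex m h)} (hc : Crosses c q) :
    ¬ q.IsDiag := by
  obtain ⟨x, y, rfl, hx, hy⟩ := hc
  intro hxy
  rw [Sym2.mk_isDiag_iff] at hxy
  exact hy (hxy ▸ hx)

/-! ### Reduction of the optical index to colouring pairs -/

/-- Two pairs of vertices are adjacent if the paths that they span are different and have a
common edge. -/
def pairGraph (m h : ℕ) : SimpleGraph (Sym2 (TreeVertex m h)) where
  Adj q r := q ≠ r ∧ ∃ c, Crosses c q ∧ Crosses c r
  symm := ⟨fun _ _ h => ⟨h.1.symm, h.2.imp fun _ hc => hc.symm⟩⟩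
  loopless := ⟨fun _ h => h.1 rfl⟩

theorem isRouting_pathEdges :
    IsRouting (completeTree m h) (pathEdges '' {q | ¬ q.IsDiag}) where
  isPath := by
    rintro P ⟨q, hq, rfl⟩
    induction q with
    | _ u v => exact ⟨u, v, hq, isPathBetween_iff.2 rfl⟩
  existsUnique u v huv :=
    ⟨pathEdges s(u, v), ⟨⟨s(u, v), huv, rfl⟩, isPathBetween_iff.2 rfl⟩,
      fun _ hP => isPathBetween_iff.1 hP.2⟩

theorem opticalIndex_le {n : ℕ} (hn : (pairGraph m h).Colorable n) :
    opticalIndex (completeTree m h) ≤ n := by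
  refine (iInf₂_le _ (isRouting_pathEdges (m := m) (h := h))).trans ?_
  apply SimpleGraph.Colorable.chromaticNumber_le
  obtain ⟨C⟩ := hn
  refine ⟨SimpleGraph.Coloring.mk (fun P => C P.2.choose) ?_⟩
  rintro P P' ⟨hne, e, he, he'⟩
  have hP := P.2.choose_spec.2
  have hP' := P'.2.choose_spec.2
  apply C.valid
  refine ⟨fun heq => hne (Subtype.ext ?_), ?_⟩
  · rw [← hP, ← hP', heq]
  · rw [← hP] at he
    rw [← hP'] at he'
    obtain ⟨c, hc, rfl⟩ := he
    exact ⟨c, hc, (upEdge_mem_pathEdges hc.ne_nil).1 he'⟩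

theorem le_opticalIndex (hm : 1 ≤ m) (hh : 1 ≤ h) {n : ℕ}
    (hn : ∀ k, (pairGraph m h).Colorable k → n ≤ k) :
    (n : ℕ∞) ≤ opticalIndex (completeTree m h) := by
  refine le_iInf₂ fun R hR => ?_
  rw [SimpleGraph.le_chromaticNumber_iff_colorable]
  rintro k ⟨C⟩
  refine hn k ?_
  have hmem : ∀ q : Sym2 (TreeVertex m h), ¬ q.IsDiag → pathEdges q ∈ R := by
    intro q hq
    induction q with
    | _ u v =>
      obtain ⟨P, ⟨hP, hPuv⟩, -⟩ := hR.existsUnique u v hq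
      rwa [← isPathBetween_iff.1 hPuv]
  -- Diagonal pairs span no path of the routing but still need a colour; `k0` is the default,
  -- available because the tree has an edge.
  have k0 : Fin k := C ⟨pathEdges s(⟨[], by simp⟩, ⟨[⟨0, hm⟩], by simpa using hh⟩),
    hmem _ (by simp [Subtype.ext_iff])⟩
  classical
  refine ⟨SimpleGraph.Coloring.mk
    (fun q => if hq : ¬ q.IsDiag then C ⟨pathEdges q, hmem q hq⟩ else k0) ?_⟩
  rintro q r ⟨hne, c, hq, hr⟩
  rw [dif_pos hq.not_isDiag, dif_pos hr.not_isDiag]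
  apply C.valid
  refine ⟨fun heq => hne (eq_of_crosses_iff hq.not_isDiag hr.not_isDiag fun d => ?_), upEdge c,
    ⟨c, hq, rfl⟩, ⟨c, hr, rfl⟩⟩
  have heq : pathEdges q = pathEdges r := congrArg Subtype.val heq
  by_cases hd : d.1 = []
  · exact ⟨fun h => absurd hd h.ne_nil, fun h => absurd hd h.ne_nil⟩
  · rw [← upEdge_mem_pathEdges hd, heq, upEdge_mem_pathEdges hd]

/-! ### Greedy colouring along a rank -/

/-- The elements of rank 0 keep a given colouring, and the others are added in order of increasing
rank. Each then sees fewer than `n` coloured neighbours, so a colour is free. -/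
theorem colorable_of_rank {α : Type*} [Finite α] (G : SimpleGraph α) (r : α → ℕ) (n : ℕ)
    (h0 : ∃ C : α → Fin n, ∀ a b, r a = 0 → r b = 0 → G.Adj a b → C a ≠ C b)
    (hr : ∀ a, r a ≠ 0 → {b | G.Adj a b ∧ r b ≤ r a}.ncard < n) : G.Colorable n := by
  classical
  have := Fintype.ofFinite α
  obtain ⟨C₀, hC₀⟩ := h0
  have key : ∀ s : Finset α, ∃ C : α → Fin n, ∀ a ∈ s, ∀ b ∈ s, G.Adj a b → C a ≠ C b := by
    intro s
    induction s using Finset.induction_on_max_value r with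
    | empty => exact ⟨C₀, by simp⟩
    | insert a s ha hmax ih =>
      by_cases h : r a = 0
      · refine ⟨C₀, fun b hb c hc => hC₀ b c ?_ ?_⟩
        · rcases Finset.mem_insert.1 hb with rfl | hb
          · exact h
          · have := hmax b hb; omega
        · rcases Finset.mem_insert.1 hc with rfl | hc
          · exact h
          · have := hmax c hc; omega
      · obtain ⟨C, hC⟩ := ih
        obtain ⟨k, hk⟩ : ∃ k, k ∉ C '' {b | G.Adj a b ∧ r b ≤ r a} := by
          by_contra! hcon
          have h1 : C '' {b | G.Adj a b ∧ r b ≤ r a} = Set.univ := Set.eq_univ_of_forall hcon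
          have h2 := Set.ncard_image_le (f := C) (Set.toFinite {b | G.Adj a b ∧ r b ≤ r a})
          rw [h1, Set.ncard_univ, Nat.card_fin] at h2
          exact absurd (hr a h) (by omega)
        have hk' : ∀ b ∈ s, G.Adj a b → C b ≠ k := fun b hb hab hbk =>
          hk ⟨b, ⟨hab, hmax b hb⟩, hbk⟩
        refine ⟨Function.update C a k, fun b hb c hc hbc => ?_⟩
        rcases Finset.mem_insert.1 hb with rfl | hbs
        · rcases Finset.mem_insert.1 hc with rfl | hcs
          · exact absurd hbc (G.loopless.irrefl _)
          · rw [Function.update_self, Function.update_of_ne hbc.ne']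
            exact (hk' c hcs hbc).symm
        · rcases Finset.mem_insert.1 hc with rfl | hcs
          · rw [Function.update_self, Function.update_of_ne hbc.ne]
            exact hk' b hbs hbc.symm
          · rw [Function.update_of_ne (ne_of_mem_of_not_mem hbs ha),
              Function.update_of_ne (ne_of_mem_of_not_mem hcs ha)]
            exact hC b hbs c hcs hbc
  obtain ⟨C, hC⟩ := key Finset.univ
  exact ⟨SimpleGraph.Coloring.mk C fun {a b} => hC a (Finset.mem_univ a) b (Finset.mem_univ b)⟩

/-! ### Sizes of subtrees, cuts and stars -/

/-- `geom m k = 1 + m + ⋯ + m ^ (k - 1)` is the order of the complete `m`-ary tree of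
height `k - 1`. -/
def geom (m k : ℕ) : ℕ := ∑ i ∈ Finset.range k, m ^ i

theorem geom_zero (m : ℕ) : geom m 0 = 0 := by simp [geom]

theorem geom_succ (m k : ℕ) : geom m (k + 1) = m * geom m k + 1 := by
  rw [geom, geom, geom_sum_succ]

theorem geom_mono (m : ℕ) {j k : ℕ} (hjk : j ≤ k) : geom m j ≤ geom m k :=
  Finset.sum_le_sum_of_subset (Finset.range_mono hjk)

theorem geom_eq (m k : ℕ) : m ^ k + geom m k = m * geom m k + 1 := by
  rw [← geom_succ, geom, geom, Finset.sum_range_succ, add_comm]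

noncomputable instance fintypeTreeVertex : Fintype (TreeVertex m h) :=
  have : Finite (TreeVertex m h) := (List.finite_length_le (Fin m) h).to_subtype
  Fintype.ofFinite _

/-- A vertex is the root or is given by its first letter and the remaining word. -/
def splitEquiv (m h : ℕ) : TreeVertex m (h + 1) ≃ Option (Fin m × TreeVertex m h) where
  toFun
    | ⟨[], _⟩ => none
    | ⟨i :: l, hl⟩ => some (i, ⟨l, by simpa using hl⟩)
  invFun
    | none => ⟨[], by simp⟩
    | some (i, l) => ⟨i :: l.1, by simpa using l.2⟩
  left_inv := by rintro ⟨_ | ⟨i, l⟩, hl⟩ <;> rfl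
  right_inv := by rintro (_ | ⟨i, l⟩) <;> rfl

theorem card_treeVertex (m h : ℕ) : Fintype.card (TreeVertex m h) = geom m (h + 1) := by
  induction h with
  | zero =>
    rw [geom_succ, geom_zero, mul_zero, zero_add, Fintype.card_eq_one_iff]
    exact ⟨⟨[], by simp⟩, fun y => Subtype.ext (List.length_eq_zero_iff.1 (by have := y.2; omega))⟩
  | succ h ih =>
    rw [Fintype.card_congr (splitEquiv m h), Fintype.card_option, Fintype.card_prod, ih,
      Fintype.card_fin, geom_succ m (h + 1)]

/-- The vertices of the subtree rooted at `c`. -/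
noncomputable def below (c : TreeVertex m h) : Finset (TreeVertex m h) :=
  Finset.univ.filter fun x => c.1 <+: x.1

theorem mem_below {c x : TreeVertex m h} : x ∈ below c ↔ c.1 <+: x.1 := by
  simp [below]

theorem card_below (c : TreeVertex m h) : (below c).card = geom m (h + 1 - c.1.length) := by
  have hc := c.2
  rw [show h + 1 - c.1.length = (h - c.1.length) + 1 by omega, ← card_treeVertex,
    ← Finset.card_univ]
  symm
  refine Finset.card_bij (fun x _ => ⟨c.1 ++ x.1, ?_⟩) ?_ ?_ ?_
  · have := x.2; simp; omega
  · intro x _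
    exact mem_below.2 (List.prefix_append _ _)
  · intro x _ y _ hxy
    exact Subtype.ext (List.append_cancel_left (congrArg Subtype.val hxy))
  · intro y hy
    obtain ⟨t, ht⟩ := mem_below.1 hy
    refine ⟨⟨t, ?_⟩, Finset.mem_univ _, Subtype.ext ht⟩
    have := y.2
    rw [← ht] at this
    simp at this
    omega

/-- Ordered pairs with the first member inside and the second one outside of the subtree
rooted at `c`. -/
noncomputable def cut (c : TreeVertex m h) : Finset (TreeVertex m h × TreeVertex m h) :=
  below c ×ˢ (below c)ᶜ

theorem mem_cut {c : TreeVertex m h} {p : TreeVertex m h × TreeVertex m h} :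
    p ∈ cut c ↔ c.1 <+: p.1.1 ∧ ¬ c.1 <+: p.2.1 := by
  simp [cut, mem_below]

theorem card_cut (c : TreeVertex m h) :
    (cut c).card = geom m (h + 1 - c.1.length) *
      (geom m (h + 1) - geom m (h + 1 - c.1.length)) := by
  rw [cut, Finset.card_product, Finset.card_compl, card_below, card_treeVertex]

/-- For two children `c`, `d` of `z`: each pair of vertices in different components of the tree
without `z`, at least one of them below `c` or `d`, is represented by one ordered pair. -/
noncomputable def star (z c d : TreeVertex m h) : Finset (TreeVertex m h × TreeVertex m h) :=
  below c ×ˢ (insert z (below c))ᶜ ∪ below d ×ˢ (insert z (below c ∪ below d))ᶜ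

theorem mem_star {z c d : TreeVertex m h} {p : TreeVertex m h × TreeVertex m h} :
    p ∈ star z c d ↔ (c.1 <+: p.1.1 ∧ ¬ c.1 <+: p.2.1 ∧ p.2 ≠ z) ∨
      (d.1 <+: p.1.1 ∧ ¬ c.1 <+: p.2.1 ∧ ¬ d.1 <+: p.2.1 ∧ p.2 ≠ z) := by
  simp [star, mem_below]
  tauto

theorem not_prefix_of_ne {c d x : TreeVertex m h} (hcd : c ≠ d)
    (hl : c.1.length = d.1.length) (hc : c.1 <+: x.1) : ¬ d.1 <+: x.1 := fun hd =>
  hcd (Subtype.ext ((List.prefix_of_prefix_length_le hc hd hl.le).eq_of_length hl))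

theorem card_star {z c d : TreeVertex m h} (hcd : c ≠ d) (hc : IsChild z c) (hd : IsChild z d) :
    (star z c d).card = geom m (h + 1 - c.1.length) *
        (geom m (h + 1) - (geom m (h + 1 - c.1.length) + 1)) +
      geom m (h + 1 - c.1.length) *
        (geom m (h + 1) - (2 * geom m (h + 1 - c.1.length) + 1)) := by
  have hlc := hc.length_eq
  have hld := hd.length_eq
  have hl : c.1.length = d.1.length := by omega
  have hdisj : Disjoint (below c) (below d) := Finset.disjoint_left.2 fun x hx hx' =>
    not_prefix_of_ne hcd hl (mem_below.1 hx) (mem_below.1 hx')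
  have hz : ∀ e : TreeVertex m h, z.1.length < e.1.length → z ∉ below e := fun e he hze => by
    have := (mem_below.1 hze).length_le
    omega
  rw [star, Finset.card_union_of_disjoint, Finset.card_product, Finset.card_product,
    Finset.card_compl, Finset.card_compl, Finset.card_insert_of_notMem (hz c (by omega)),
    Finset.card_insert_of_notMem, Finset.card_union_of_disjoint hdisj, card_below, card_below,
    card_treeVertex, ← hl, two_mul]
  · rw [Finset.mem_union, not_or]
    exact ⟨hz c (by omega), hz d (by omega)⟩
  · rw [Finset.disjoint_product]
    exact Or.inl hdisj

/-! ### Common prefixes and the order in which paths are coloured -/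

/-- The length of the longest common prefix. -/
def lcpLength {α : Type*} [DecidableEq α] : List α → List α → ℕ
  | a :: x, b :: y => if a = b then lcpLength x y + 1 else 0
  | _, _ => 0

theorem lcpLength_comm {α : Type*} [DecidableEq α] (x y : List α) :
    lcpLength x y = lcpLength y x := by
  induction x generalizing y with
  | nil => cases y <;> rfl
  | cons a x ih =>
    cases y with
    | nil => rfl
    | cons b y => simp only [lcpLength, ih y, eq_comm]

theorem length_le_lcpLength {α : Type*} [DecidableEq α] {c x y : List α} (hx : c <+: x)
    (hy : c <+: y) : c.length ≤ lcpLength x y := by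
  induction c generalizing x y with
  | nil => simp
  | cons a c ih =>
    obtain ⟨x, rfl⟩ := hx
    obtain ⟨y, rfl⟩ := hy
    have := ih (List.prefix_append c x) (List.prefix_append c y)
    simpa [lcpLength] using this

theorem exists_eq_append_of_lcpLength {α : Type*} [DecidableEq α] (x y : List α) :
    ∃ z x' y', x = z ++ x' ∧ y = z ++ y' ∧ lcpLength x y = z.length ∧
      ∀ i x'' j y'', x' = i :: x'' → y' = j :: y'' → i ≠ j := by
  induction x generalizing y with
  | nil => exact ⟨[], [], y, rfl, rfl, by cases y <;> rfl, by simp⟩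
  | cons a x ih =>
    cases y with
    | nil => exact ⟨[], a :: x, [], rfl, rfl, rfl, by simp⟩
    | cons b y =>
      by_cases hab : a = b
      · obtain ⟨z, x', y', h1, h2, h3, h4⟩ := ih y
        subst hab
        refine ⟨a :: z, x', y', by rw [h1]; rfl, by rw [h2]; rfl, by simp [lcpLength, h3], h4⟩
      · refine ⟨[], a :: x, b :: y, rfl, rfl, by simp [lcpLength, hab], ?_⟩
        rintro i x'' j y'' h1 h2
        simp only [List.cons.injEq] at h1 h2
        rw [← h1.1, ← h2.1]
        exact hab

/-- Paths are ordered by the depth of their vertex closest to the root; among those with the same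
depth, the paths for which that vertex is terminal come last. -/
def pairRank : Sym2 (TreeVertex m h) → ℕ :=
  Sym2.lift ⟨fun x y => 2 * lcpLength x.1 y.1 + if x.1 <+: y.1 ∨ y.1 <+: x.1 then 1 else 0,
    fun x y => by simp only [lcpLength_comm x.1, or_comm]⟩

theorem pairRank_mk (x y : TreeVertex m h) :
    pairRank s(x, y) = 2 * lcpLength x.1 y.1 + if x.1 <+: y.1 ∨ y.1 <+: x.1 then 1 else 0 :=
  rfl

/-- The shared edge, above `d`, lies at or below the edge above `c`, so `u` is below `c`. If `v`
were too, the top of the second path would be deeper than `z` and its rank at least `2 * z.1.length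
+ 2`. -/
theorem mem_cut_of_common_crossing {z c x y d u v : TreeVertex m h} (hzc : IsChild z c)
    (hcx : c.1 <+: x.1) (hzy : z.1 <+: y.1)
    (hdx : d.1 <+: x.1) (hdy : ¬ d.1 <+: y.1) (hdu : d.1 <+: u.1)
    (hr : pairRank s(u, v) ≤ 2 * z.1.length + 1) :
    c.1 <+: u.1 ∧ ¬ c.1 <+: v.1 := by
  have hlc := hzc.length_eq
  obtain ⟨t, ht⟩ := hzc
  have hcd : c.1 <+: d.1 := by
    rcases List.prefix_or_prefix_of_prefix hcx hdx with h1 | h1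
    · exact h1
    · have h2 := h1
      rw [ht, List.prefix_concat_iff, ← ht] at h2
      rcases h2 with h2 | h2
      · rw [h2]
      · exact absurd (h2.trans hzy) hdy
  refine ⟨hcd.trans hdu, fun hcv => ?_⟩
  have := length_le_lcpLength (hcd.trans hdu) hcv
  rw [pairRank_mk] at hr
  omega

/-- The inequality is strict because `q` itself is represented in `T` but is not its own neighbour.
-/
theorem ncard_neighbors_lt {w : ℕ} {q : Sym2 (TreeVertex m h)}
    (T : Finset (TreeVertex m h × TreeVertex m h)) (hT : T.card ≤ w)
    (hq : ∃ p ∈ T, Sym2.mk p.1 p.2 = q)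
    (H : ∀ b, (pairGraph m h).Adj q b → pairRank b ≤ pairRank q →
      ∃ p ∈ T, Sym2.mk p.1 p.2 = b) :
    {b | (pairGraph m h).Adj q b ∧ pairRank b ≤ pairRank q}.ncard < w := by
  have hss : {b | (pairGraph m h).Adj q b ∧ pairRank b ≤ pairRank q} ⊂
      (fun p : TreeVertex m h × TreeVertex m h => s(p.1, p.2)) '' T :=
    (Set.ssubset_iff_of_subset fun b hb => H b hb.1 hb.2).2
      ⟨q, hq, fun hqq => (pairGraph m h).loopless.irrefl _ hqq.1⟩
  calc _ < _ := Set.ncard_lt_ncard hss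
    _ ≤ (T : Set (TreeVertex m h × TreeVertex m h)).ncard := Set.ncard_image_le
    _ = T.card := Set.ncard_coe_finset T
    _ ≤ w := hT

/-- For a path descending from its end `x`, every conflicting path of no larger rank also uses the
first edge below `x`, so one cut contains them all. -/
theorem ncard_neighbors_lt_of_prefix {w : ℕ}
    (hcut : ∀ c : TreeVertex m h, c.1 ≠ [] → (cut c).card ≤ w)
    {x y : TreeVertex m h} (hxy : x ≠ y) (hp : x.1 <+: y.1) :
    {b | (pairGraph m h).Adj s(x, y) b ∧ pairRank b ≤ pairRank s(x, y)}.ncard < w := by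
  obtain ⟨t, ht⟩ := hp
  obtain _ | ⟨i, t⟩ := t
  · exact absurd (Subtype.ext (by simpa using ht)) hxy
  have hy := y.2
  let c : TreeVertex m h := ⟨x.1 ++ [i], by rw [← ht] at hy; simp at hy ⊢; omega⟩
  have hc : IsChild x c := ⟨i, rfl⟩
  have hcy : c.1 <+: y.1 := ⟨t, by simp [c, ← ht]⟩
  have hcx : ¬ c.1 <+: x.1 := fun h => by
    have := h.length_le
    have := hc.length_eq
    omega
  refine ncard_neighbors_lt (cut c) (hcut c hc.ne_nil)
    ⟨(y, x), mem_cut.2 ⟨hcy, hcx⟩, Sym2.eq_swap⟩ ?_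
  rintro b ⟨-, d, hd, u, v, rfl, hdu, -⟩ hr
  have hlcp : lcpLength x.1 y.1 ≤ x.1.length := by
    obtain ⟨z, x', y', h1, h2, h3, -⟩ := exists_eq_append_of_lcpLength x.1 y.1
    rw [h3]
    conv_rhs => rw [h1]
    simp
  have hr' : pairRank s(u, v) ≤ 2 * x.1.length + 1 := by
    refine hr.trans ?_
    rw [pairRank_mk]
    split_ifs <;> omega
  refine ⟨(u, v), mem_cut.2 ?_, rfl⟩
  rcases crosses_mk.1 hd with ⟨h1, h2⟩ | ⟨h1, h2⟩
  · exact absurd (h1.trans ⟨_, ht⟩) h2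
  · exact mem_cut_of_common_crossing hc hcy List.prefix_rfl h1 h2 hdu hr'

/-- Rank 0 consists of the paths with the root in their interior. A later path either ends at its
top vertex, where a cut bounds its conflicts, or turns at a non-root vertex `z` between children `c`
and `d`, where the star does. -/
theorem pairGraph_colorable {w : ℕ} (hw : 0 < w)
    (hroot : ∃ C : Sym2 (TreeVertex m h) → Fin w, ∀ q r, pairRank q = 0 → pairRank r = 0 →
      (pairGraph m h).Adj q r → C q ≠ C r)
    (hcut : ∀ c : TreeVertex m h, c.1 ≠ [] → (cut c).card ≤ w)
    (hstar : ∀ z c d : TreeVertex m h, z.1 ≠ [] → c ≠ d → IsChild z c → IsChild z d →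
      (star z c d).card ≤ w) :
    (pairGraph m h).Colorable w := by
  refine colorable_of_rank _ pairRank w hroot fun q hq => ?_
  induction q with
  | _ x y =>
  by_cases hxy : x = y
  · have : {b | (pairGraph m h).Adj s(x, y) b ∧ pairRank b ≤ pairRank s(x, y)} = ∅ := by
      ext b
      simp only [Set.mem_ofPred_eq, Set.mem_empty_iff_false, iff_false, not_and]
      rintro ⟨-, c, hc, -⟩
      exact absurd hxy hc.not_isDiag
    rw [this]
    simpa using hw
  by_cases hp : x.1 <+: y.1
  · exact ncard_neighbors_lt_of_prefix hcut hxy hp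
  by_cases hp' : y.1 <+: x.1
  · rw [Sym2.eq_swap]
    exact ncard_neighbors_lt_of_prefix hcut (Ne.symm hxy) hp'
  have hrank : pairRank s(x, y) = 2 * lcpLength x.1 y.1 := by
    rw [pairRank_mk, if_neg (by tauto), add_zero]
  obtain ⟨z, x', y', h1, h2, h3, h4⟩ := exists_eq_append_of_lcpLength x.1 y.1
  obtain _ | ⟨i, x'⟩ := x'
  · exact absurd (by rw [h1, h2]; simp) hp
  obtain _ | ⟨j, y'⟩ := y'
  · exact absurd (by rw [h1, h2]; simp) hp'
  have hij := h4 i x' j y' rfl rfl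
  have hx := x.2
  have hy := y.2
  let z₀ : TreeVertex m h := ⟨z, by rw [h1] at hx; simp at hx; omega⟩
  let c : TreeVertex m h := ⟨z ++ [i], by rw [h1] at hx; simp at hx ⊢; omega⟩
  let d : TreeVertex m h := ⟨z ++ [j], by rw [h2] at hy; simp at hy ⊢; omega⟩
  have hc : IsChild z₀ c := ⟨i, rfl⟩
  have hd : IsChild z₀ d := ⟨j, rfl⟩
  have hcd : c ≠ d := fun h => hij (by simpa [c, d] using h)
  have hl : c.1.length = d.1.length := by simp [c, d]
  have hcx : c.1 <+: x.1 := ⟨x', by simp [c, h1]⟩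
  have hdy : d.1 <+: y.1 := ⟨y', by simp [d, h2]⟩
  have hzx : z₀.1 <+: x.1 := ⟨_, h1.symm⟩
  have hzy : z₀.1 <+: y.1 := ⟨_, h2.symm⟩
  have hcy : ¬ c.1 <+: y.1 := not_prefix_of_ne hcd.symm hl.symm hdy
  have hyz : y ≠ z₀ := fun h => hp' (by rw [h]; exact hzx)
  refine ncard_neighbors_lt (star z₀ c d) (hstar z₀ c d ?_ hcd hc hd)
    ⟨(x, y), mem_star.2 (Or.inl ⟨hcx, hcy, hyz⟩), rfl⟩ ?_
  · rintro h0
    rw [hrank, h3] at hq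
    exact hq (by simpa [z₀] using h0)
  rintro b ⟨-, e, he, he'⟩ hr
  rw [hrank, h3] at hr
  -- The rank of `b` is at most `2 * z.length`, without the extra 1, so `b` cannot descend from `z`
  -- as an end. This is why paths ending at their top vertex are ranked last: the star may omit `z`.
  have hne : ∀ u v : TreeVertex m h, s(u, v) = b → z₀.1 <+: u.1 → v ≠ z₀ := by
    rintro u v rfl hu rfl
    rw [pairRank_mk, if_pos (Or.inr hu)] at hr
    have : z.length ≤ lcpLength u.1 z₀.1 := length_le_lcpLength hu (List.prefix_refl z₀.1)
    omega
  obtain ⟨u, v, rfl, heu, hev⟩ := he'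
  rcases crosses_mk.1 he with ⟨e1, e2⟩ | ⟨e1, e2⟩
  · have := mem_cut_of_common_crossing hc hcx hzy e1 e2 heu (hr.trans (Nat.le_succ _))
    exact ⟨(u, v), mem_star.2 (Or.inl ⟨this.1, this.2,
      hne u v rfl (List.IsPrefix.trans ⟨_, rfl⟩ this.1)⟩), rfl⟩
  · have := mem_cut_of_common_crossing hd hdy hzx e1 e2 heu (hr.trans (Nat.le_succ _))
    have hzu : z₀.1 <+: u.1 := List.IsPrefix.trans ⟨_, rfl⟩ this.1
    by_cases hcv : c.1 <+: v.1
    · exact ⟨(v, u), mem_star.2 (Or.inl ⟨hcv, not_prefix_of_ne hcd.symm hl.symm this.1,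
        hne v u Sym2.eq_swap (List.IsPrefix.trans ⟨_, rfl⟩ hcv)⟩), Sym2.eq_swap⟩
    · exact ⟨(u, v), mem_star.2 (Or.inr ⟨this.1, hcv, this.2, hne u v rfl hzu⟩), rfl⟩

/-! ### Explicit colouring of the paths joining different branches of the root -/

/-- The vertex of the `i`-th branch of the root that corresponds to the vertex `x`. -/
def inBranch (i : Fin m) (x : TreeVertex m h) : TreeVertex m (h + 1) :=
  ⟨i :: x.1, by simpa using x.2⟩

theorem inBranch_inj {i j : Fin m} {x y : TreeVertex m h} :
    inBranch i x = inBranch j y ↔ i = j ∧ x = y := by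
  simp [inBranch, Subtype.ext_iff]

theorem crosses_inBranch_head {c : TreeVertex m (h + 1)} {i j : Fin m} {x y : TreeVertex m h}
    (hc : Crosses c s(inBranch i x, inBranch j y)) :
    ∃ k l, c.1 = k :: l ∧ (k = i ∨ k = j) := by
  obtain ⟨c, hlc⟩ := c
  obtain _ | ⟨k, l⟩ := c
  · exact absurd rfl hc.ne_nil
  refine ⟨k, l, rfl, ?_⟩
  rcases crosses_mk.1 hc with ⟨h1, -⟩ | ⟨h1, -⟩
  · exact Or.inl (List.cons_prefix_cons.1 h1).1
  · exact Or.inr (List.cons_prefix_cons.1 h1).1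

theorem exists_inBranch_of_pairRank_eq_zero {q : Sym2 (TreeVertex m (h + 1))}
    (hq : pairRank q = 0) :
    ∃ i j x y, i < j ∧ q = s(inBranch i x, inBranch j y) := by
  induction q with
  | _ x y =>
  obtain ⟨_ | ⟨i, x⟩, hx⟩ := x
  · simp [pairRank_mk] at hq
  obtain ⟨_ | ⟨j, y⟩, hy⟩ := y
  · simp [pairRank_mk] at hq
  have hij : i ≠ j := by
    rintro rfl
    simp [pairRank_mk, lcpLength] at hq
  rcases lt_or_gt_of_ne hij with hlt | hlt
  · exact ⟨i, j, ⟨x, by simpa using hx⟩, ⟨y, by simpa using hy⟩, hlt, rfl⟩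
  · exact ⟨j, i, ⟨y, by simpa using hy⟩, ⟨x, by simpa using hx⟩, hlt, Sym2.eq_swap⟩

/-- The colour of a path records the colour of its pair of branches and the positions of its ends.
Paths sharing an edge share a branch, so equal colours force the same second branch by properness of
`χ`. -/
theorem exists_coloring_of_pairRank_eq_zero {w K : ℕ} (hw : 0 < w) (χ : Fin m → Fin m → Fin K)
    (hsymm : ∀ i j, χ i j = χ j i)
    (hχ : ∀ i j k, j ≠ i → k ≠ i → χ i j = χ i k → j = k)
    (hK : K * geom m (h + 1) ^ 2 ≤ w) :
    ∃ C : Sym2 (TreeVertex m (h + 1)) → Fin w, ∀ q r, pairRank q = 0 → pairRank r = 0 →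
      (pairGraph m (h + 1)).Adj q r → C q ≠ C r := by
  classical
  obtain ⟨e⟩ : Nonempty (Fin K × TreeVertex m h × TreeVertex m h ↪ Fin w) := by
    apply Function.Embedding.nonempty_of_card_le
    rw [Fintype.card_prod, Fintype.card_prod, card_treeVertex, Fintype.card_fin, Fintype.card_fin,
      ← sq]
    exact hK
  have hC : ∀ q : Sym2 (TreeVertex m (h + 1)), ∃ k : Fin w, pairRank q = 0 →
      ∃ i j x y, i < j ∧ q = s(inBranch i x, inBranch j y) ∧ k = e (χ i j, x, y) := by
    intro q
    by_cases hq : pairRank q = 0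
    · obtain ⟨i, j, x, y, hij, h1⟩ := exists_inBranch_of_pairRank_eq_zero hq
      exact ⟨_, fun _ => ⟨i, j, x, y, hij, h1, rfl⟩⟩
    · exact ⟨⟨0, hw⟩, fun h => absurd h hq⟩
  choose C hC using hC
  refine ⟨C, fun q r hq hr hqr heq => ?_⟩
  obtain ⟨i, j, x, y, hij, rfl, h1⟩ := hC q hq
  obtain ⟨i', j', x', y', hij', rfl, h2⟩ := hC r hr
  rw [h1, h2] at heq
  have heq := e.injective heq
  simp only [Prod.mk.injEq] at heq
  obtain ⟨h3, rfl, rfl⟩ := heq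
  obtain ⟨hne, c, hc, hc'⟩ := hqr
  obtain ⟨k, l, hk, hk1⟩ := crosses_inBranch_head hc
  obtain ⟨k', l', hk', hk2⟩ := crosses_inBranch_head hc'
  rw [hk, List.cons.injEq] at hk'
  obtain ⟨rfl, -⟩ := hk'
  -- Positions are listed with the smaller branch first. In the two mixed cases the common branch is
  -- the smaller one for one path and the larger one for the other, which contradicts the order.
  rcases hk1 with rfl | rfl <;> rcases hk2 with rfl | rfl
  · obtain rfl := hχ _ _ _ hij.ne' hij'.ne' h3
    exact hne rfl
  · rw [hsymm i' k] at h3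
    obtain rfl := hχ _ _ _ hij.ne' hij'.ne h3
    exact absurd hij (not_lt.2 hij'.le)
  · rw [hsymm i k] at h3
    obtain rfl := hχ _ _ _ hij.ne hij'.ne' h3
    exact absurd hij (not_lt.2 hij'.le)
  · rw [hsymm i, hsymm i'] at h3
    obtain rfl := hχ _ _ _ hij.ne hij'.ne h3
    exact hne rfl

theorem exists_edge_coloring_of_odd (m : ℕ) [NeZero m] :
    ∃ χ : Fin m → Fin m → Fin m, (∀ i j, χ i j = χ j i) ∧
      ∀ i j k, j ≠ i → k ≠ i → χ i j = χ i k → j = k :=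
  ⟨fun i j => i + j, fun i j => add_comm i j, fun _ _ _ _ _ h => add_left_cancel h⟩

/-- The classical round-robin colouring: the vertex `n` plays the point at infinity, the edge from
it to `j` gets `2 * j` modulo `n`, and other edges get `i + j`. Doubling is injective modulo the odd
number `n`. -/
theorem exists_edge_coloring_of_even {n : ℕ} (hn : Odd n) :
    ∃ χ : Fin (n + 1) → Fin (n + 1) → Fin n, (∀ i j, χ i j = χ j i) ∧
      ∀ i j k, j ≠ i → k ≠ i → χ i j = χ i k → j = k := by
  have hpos := hn.pos
  let v : Fin (n + 1) → Fin (n + 1) → ℕ := fun i j =>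
    (if i.1 = n then j.1 else i.1) + (if j.1 = n then i.1 else j.1)
  refine ⟨fun i j => ⟨v i j % n, Nat.mod_lt _ hpos⟩, fun i j => ?_, fun i j k hj hk hjk => ?_⟩
  · simp only [v, add_comm]
  have hjk : v i j ≡ v i k [MOD n] := congrArg Fin.val hjk
  have hi' := i.2
  have hj' := j.2
  have hk' := k.2
  have hji : j.1 ≠ i.1 := fun h => hj (Fin.ext h)
  have hki : k.1 ≠ i.1 := fun h => hk (Fin.ext h)
  apply Fin.ext
  have cancel : ∀ a b c : ℕ, b < n → c < n → a + b ≡ a + c [MOD n] → b = c :=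
    fun a b c hb hc h => (Nat.ModEq.add_left_cancel' a h).eq_of_lt_of_lt hb hc
  simp only [v] at hjk
  by_cases hi : i.1 = n
  · rw [if_pos hi, if_pos hi, if_neg (by omega), if_neg (by omega), ← two_mul, ← two_mul] at hjk
    exact (Nat.ModEq.cancel_left_of_coprime
      (Nat.coprime_two_right.2 hn) hjk).eq_of_lt_of_lt (by omega) (by omega)
  · rw [if_neg hi, if_neg hi] at hjk
    by_cases h1 : j.1 = n <;> by_cases h2 : k.1 = n
    · omega
    · rw [if_pos h1, if_neg h2] at hjk
      exact absurd (cancel _ _ _ (by omega) (by omega) hjk) hki.symm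
    · rw [if_neg h1, if_pos h2] at hjk
      exact absurd (cancel _ _ _ (by omega) (by omega) hjk) hji
    · rw [if_neg h1, if_neg h2] at hjk
      exact cancel _ _ _ (by omega) (by omega) hjk

/-! ### Lower bounds from cliques and parity -/

theorem card_le_of_colorable {k : ℕ} (hk : (pairGraph m h).Colorable k)
    (T : Finset (TreeVertex m h × TreeVertex m h))
    (hT : ∀ p ∈ T, ∀ p' ∈ T, (∃ c, Crosses c s(p.1, p.2) ∧ Crosses c s(p'.1, p'.2)) ∧
      ¬ (p.1 = p'.2 ∧ p.2 = p'.1)) : T.card ≤ k := by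
  obtain ⟨C⟩ := hk
  have hinj : Set.InjOn (fun p : TreeVertex m h × TreeVertex m h => C s(p.1, p.2)) T := by
    intro p hp p' hp' heq
    obtain ⟨hc, hne⟩ := hT p hp p' hp'
    by_contra hpp
    refine C.valid ⟨fun hs => ?_, hc⟩ heq
    rcases Sym2.eq_iff.1 hs with h1 | h1
    · exact hpp (Prod.ext h1.1 h1.2)
    · exact hne h1
  simpa using Finset.card_le_card_of_injOn (t := Finset.univ) _ (by simp) hinj

theorem card_cut_le_of_colorable {k : ℕ} (hk : (pairGraph m h).Colorable k)
    (c : TreeVertex m h) : (cut c).card ≤ k := by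
  refine card_le_of_colorable hk _ fun p hp p' hp' => ?_
  rw [mem_cut] at hp hp'
  refine ⟨⟨c, ⟨_, _, rfl, hp⟩, ⟨_, _, rfl, hp'⟩⟩, fun heq => ?_⟩
  rw [← heq.1] at hp'
  exact hp'.2 hp.1

/-- By `hz`, only three components remain when `z` is removed: below `c`, below `d`, and the part
outside the subtree of `z`. A path between two of them uses two of the three edges at `z`, so any
two such paths share an edge. -/
theorem card_star_le_of_colorable {k : ℕ} (hk : (pairGraph m h).Colorable k)
    {z c d : TreeVertex m h} (hcd : c ≠ d) (hc : IsChild z c) (hd : IsChild z d)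
    (hz : ∀ v : TreeVertex m h, z.1 <+: v.1 → v = z ∨ c.1 <+: v.1 ∨ d.1 <+: v.1) :
    (star z c d).card ≤ k := by
  have hlc := hc.length_eq
  have hld := hd.length_eq
  have hzc : z.1 <+: c.1 := by obtain ⟨t, ht⟩ := hc; exact ⟨_, ht.symm⟩
  have hzd : z.1 <+: d.1 := by obtain ⟨t, ht⟩ := hd; exact ⟨_, ht.symm⟩
  have mixed : ∀ x y x' y' : TreeVertex m h, c.1 <+: x.1 → ¬ c.1 <+: y.1 → y ≠ z →
      d.1 <+: x'.1 → ¬ c.1 <+: y'.1 → ¬ d.1 <+: y'.1 → y' ≠ z →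
      ∃ e, Crosses e s(x, y) ∧ Crosses e s(x', y') := by
    intro x y x' y' hx hy hyz hx' hcy' hdy' hyz'
    by_cases hdy : d.1 <+: y.1
    · exact ⟨d, ⟨y, x, Sym2.eq_swap, hdy, not_prefix_of_ne hcd (by omega) hx⟩,
        ⟨x', y', rfl, hx', hdy'⟩⟩
    · exact ⟨z, ⟨x, y, rfl, hzc.trans hx, fun h => by rcases hz y h with h | h | h <;> contradiction⟩,
        ⟨x', y', rfl, hzd.trans hx',
          fun h => by rcases hz y' h with h | h | h <;> contradiction⟩⟩
  refine card_le_of_colorable hk _ fun p hp p' hp' => ?_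
  obtain ⟨x, y⟩ := p
  obtain ⟨x', y'⟩ := p'
  rw [mem_star] at hp hp'
  dsimp only at hp hp' ⊢
  rcases hp with ⟨hx, hy, hyz⟩ | ⟨hx, hcy, hdy, hyz⟩ <;>
    rcases hp' with ⟨hx', hy', hyz'⟩ | ⟨hx', hcy', hdy', hyz'⟩
  · exact ⟨⟨c, ⟨_, _, rfl, hx, hy⟩, ⟨_, _, rfl, hx', hy'⟩⟩, fun h => hy' (h.1 ▸ hx)⟩
  · exact ⟨mixed x y x' y' hx hy hyz hx' hcy' hdy' hyz', fun h => hcy' (h.1 ▸ hx)⟩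
  · refine ⟨?_, fun h => hcy (h.2 ▸ hx')⟩
    obtain ⟨e, he, he'⟩ := mixed x' y' x y hx' hy' hyz' hx hcy hdy hyz
    exact ⟨e, he', he⟩
  · exact ⟨⟨d, ⟨_, _, rfl, hx, hdy⟩, ⟨_, _, rfl, hx', hdy'⟩⟩, fun h => hdy' (h.1 ▸ hx)⟩

/-- Paths of one colour joining different branches use disjoint pairs of branches, so an odd `m`
leaves at least one branch unused. The count is made over ordered pairs, where each colour occurs at
most `m - 1` times. -/
theorem mul_sq_le_of_colorable (hm : Odd m) (hm1 : 1 < m) {k : ℕ}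
    (hk : (pairGraph m (h + 1)).Colorable k) : m * geom m (h + 1) ^ 2 ≤ k := by
  classical
  obtain ⟨C⟩ := hk
  let f : (Fin m × Fin m) × TreeVertex m h × TreeVertex m h → Fin k :=
    fun o => C s(inBranch o.1.1 o.2.1, inBranch o.1.2 o.2.2)
  let O : Finset ((Fin m × Fin m) × TreeVertex m h × TreeVertex m h) :=
    Finset.univ.offDiag ×ˢ Finset.univ
  have hO : ∀ o, o ∈ O ↔ o.1.1 ≠ o.1.2 := fun o => by simp [O]
  have hcard : O.card = (m * m - m) * geom m (h + 1) ^ 2 := by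
    rw [Finset.card_product, Finset.offDiag_card, Finset.card_univ, Finset.card_univ,
      Fintype.card_prod, card_treeVertex, Fintype.card_fin, sq]
  have hfiber : ∀ a : Fin k, (O.filter fun o => f o = a).card ≤ m - 1 := by
    intro a
    have hle : (O.filter fun o => f o = a).card ≤ m := by
      have hinj : Set.InjOn (fun o : (Fin m × Fin m) × TreeVertex m h × TreeVertex m h => o.1.1)
          (O.filter fun o => f o = a) := by
        rintro ⟨⟨i, j⟩, x, y⟩ ho ⟨⟨i', j'⟩, x', y'⟩ ho' hi
        simp only [Finset.coe_filter, Set.mem_ofPred_eq, hO] at ho ho'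
        obtain ⟨hij, hf⟩ := ho
        obtain ⟨hij', hf'⟩ := ho'
        obtain rfl : i = i' := hi
        by_contra hne
        refine C.valid ⟨fun hs => hne ?_, ⟨⟨[i], by simp⟩, ?_, ?_⟩⟩ (hf.trans hf'.symm)
        · rcases Sym2.eq_iff.1 hs with ⟨h1, h2⟩ | ⟨h1, h2⟩
          · obtain ⟨-, rfl⟩ := inBranch_inj.1 h1
            obtain ⟨h3, rfl⟩ := inBranch_inj.1 h2
            obtain rfl : j = j' := h3
            rfl
          · exact absurd (inBranch_inj.1 h1).1 hij'
        · exact crosses_mk.2 (Or.inl (by simpa [inBranch] using hij))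
        · exact crosses_mk.2 (Or.inl (by simpa [inBranch] using hij'))
      simpa using Finset.card_le_card_of_injOn (t := Finset.univ) _ (by simp) hinj
    -- Swapping the two ends is an involution without fixed points on the fibre.
    have heven : Even (O.filter fun o => f o = a).card := by
      rw [← ZMod.natCast_eq_zero_iff_even, Finset.card_eq_sum_ones, Nat.cast_sum]
      refine Finset.sum_involution (fun o _ => (o.1.swap, o.2.swap)) ?_ ?_ ?_ ?_
      · intro o _
        decide
      · intro o ho _ heq
        simp only [Finset.mem_filter, hO] at ho
        exact ho.1 (congrArg (fun o => o.1.2) heq)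
      · intro o ho
        simp only [Finset.mem_filter, hO] at ho ⊢
        refine ⟨ho.1.symm, ?_⟩
        rw [← ho.2]
        exact congrArg C Sym2.eq_swap
      · intro o _
        rfl
    have : (O.filter fun o => f o = a).card ≠ m := fun h =>
      (Nat.not_even_iff_odd.2 hm) (h ▸ heven)
    omega
  have h1 := Finset.card_le_mul_card_image_of_maps_to (f := f) (s := O) (t := Finset.univ)
    (fun _ _ => Finset.mem_univ _) (m - 1) (fun a _ => hfiber a)
  rw [hcard, Finset.card_univ, Fintype.card_fin] at h1
  have h2 : m * m - m = (m - 1) * m := by rw [Nat.sub_mul, one_mul]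
  rw [h2, mul_assoc] at h1
  exact Nat.le_of_mul_le_mul_left h1 (by omega)

/-! ### Comparison of the bounds -/

theorem geom_pos (m k : ℕ) : 0 < geom m (k + 1) := by
  rw [geom_succ]; omega

theorem geom_succ_sub (m k : ℕ) : geom m (k + 1) - geom m k = m ^ k := by
  rw [geom, geom, Finset.sum_range_succ]; omega

theorem geom_one (k : ℕ) : geom 1 k = k := by simp [geom]

theorem geom_two (k : ℕ) : geom 2 k + 1 = 2 ^ k := by
  have := geom_eq 2 k
  omega

theorem mul_sub_le_mul_sub {b s N : ℕ} (hbs : b ≤ s) (hs : 2 * s ≤ N) :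
    b * (N - b) ≤ s * (N - s) := by
  obtain ⟨t, rfl⟩ := Nat.exists_eq_add_of_le hbs
  obtain ⟨r, rfl⟩ := Nat.exists_eq_add_of_le hs
  rw [show 2 * (b + t) + r - b = b + 2 * t + r by omega,
    show 2 * (b + t) + r - (b + t) = b + t + r by omega]
  nlinarith [Nat.zero_le (t * t), Nat.zero_le (t * r)]

/-- The sum is `2 * M * b - 3 * b ^ 2`, which increases up to `b = M / 3`. -/
theorem star_count_mono {b a M : ℕ} (hba : b ≤ a) (ha : 3 * a ≤ M) :
    b * (M + 1 - (b + 1)) + b * (M + 1 - (2 * b + 1)) ≤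
      a * (M + 1 - (a + 1)) + a * (M + 1 - (2 * a + 1)) := by
  obtain ⟨t, rfl⟩ := Nat.exists_eq_add_of_le hba
  obtain ⟨r, rfl⟩ := Nat.exists_eq_add_of_le ha
  rw [show 3 * (b + t) + r + 1 - (b + 1) = 2 * b + 3 * t + r by omega,
    show 3 * (b + t) + r + 1 - (2 * b + 1) = b + 3 * t + r by omega,
    show 3 * (b + t) + r + 1 - (b + t + 1) = 2 * b + 2 * t + r by omega,
    show 3 * (b + t) + r + 1 - (2 * (b + t) + 1) = b + t + r by omega]
  nlinarith [Nat.zero_le (t * t), Nat.zero_le (t * r)]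

/-- Cuts are largest at the edges of the root, and stars at non-root vertices are largest at depth
one, so one bound of each kind suffices. -/
theorem pairGraph_colorable_of_edge_coloring {w K : ℕ} (hm : 2 ≤ m)
    (hχ : ∃ χ : Fin m → Fin m → Fin K, (∀ i j, χ i j = χ j i) ∧
      ∀ i j k, j ≠ i → k ≠ i → χ i j = χ i k → j = k)
    (hK : K * geom m (h + 1) ^ 2 ≤ w)
    (hload : geom m (h + 1) * m ^ (h + 1) ≤ w)
    (hstar : geom m h * (geom m (h + 2) - (geom m h + 1)) +
      geom m h * (geom m (h + 2) - (2 * geom m h + 1)) ≤ w) :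
    (pairGraph m (h + 1)).Colorable w := by
  have hw : 0 < w := lt_of_lt_of_le (Nat.mul_pos (geom_pos m h) (by positivity)) hload
  obtain ⟨χ, hsymm, hχ⟩ := hχ
  refine pairGraph_colorable hw
    (exists_coloring_of_pairRank_eq_zero hw χ hsymm hχ hK) (fun c hc => ?_)
    fun z c d hz hcd hzc hzd => ?_
  · have hc' := List.length_pos_iff.2 hc
    rw [card_cut]
    refine le_trans (mul_sub_le_mul_sub (geom_mono m (j := h + 1 + 1 - c.1.length)
      (k := h + 1) (by omega)) ?_) ?_
    · rw [geom_succ m (h + 1)]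
      nlinarith
    · rwa [geom_succ_sub]
  · have hz' := List.length_pos_iff.2 hz
    have hl := hzc.length_eq
    rw [card_star hcd hzc hzd]
    refine le_trans ?_ hstar
    rw [geom_succ m (h + 1)]
    apply star_count_mono (geom_mono m (by omega))
    rw [geom_succ m h]
    nlinarith [Nat.mul_le_mul hm hm, Nat.zero_le (geom m h)]

theorem star_count_le (hm : 3 ≤ m) (h : ℕ) :
    geom m h * (geom m (h + 2) - (geom m h + 1)) +
      geom m h * (geom m (h + 2) - (2 * geom m h + 1)) ≤ (m - 1) * geom m (h + 1) ^ 2 := by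
  have h1 : geom m (h + 2) = m * geom m (h + 1) + 1 := geom_succ m (h + 1)
  have h2 : m * geom m h ≤ geom m (h + 1) := by rw [geom_succ]; omega
  calc _ ≤ geom m h * (m * geom m (h + 1)) + geom m h * (m * geom m (h + 1)) :=
        Nat.add_le_add (Nat.mul_le_mul_left _ (by omega)) (Nat.mul_le_mul_left _ (by omega))
    _ = 2 * ((m * geom m h) * geom m (h + 1)) := by ring
    _ ≤ (m - 1) * (geom m (h + 1) * geom m (h + 1)) :=
        Nat.mul_le_mul (by omega) (Nat.mul_le_mul_right _ h2)
    _ = _ := by rw [sq]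

/-- The load of an edge at the root splits into the paths to the other `m - 1` branches and those
ending at the root. -/
theorem geom_mul_pow_eq (hm : 1 ≤ m) (h : ℕ) :
    geom m h * m ^ h = (m - 1) * geom m h ^ 2 + geom m h := by
  obtain ⟨n, rfl⟩ := Nat.exists_eq_add_of_le hm
  have h1 : (1 + n) ^ h = n * geom (1 + n) h + 1 := by
    have := geom_eq (1 + n) h
    rw [add_mul, one_mul] at this
    omega
  rw [h1, Nat.add_sub_cancel_left]
  ring

theorem load_le_of_colorable (hm : 1 ≤ m) {k : ℕ} (hk : (pairGraph m (h + 1)).Colorable k) :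
    geom m (h + 1) * m ^ (h + 1) ≤ k := by
  have := card_cut_le_of_colorable hk ⟨[⟨0, hm⟩], by simp⟩
  rw [card_cut] at this
  simpa [geom_succ_sub] using this

/-! ### Values of the optical index -/

theorem opticalIndex_of_odd (hm : Odd m) (hm3 : 3 ≤ m) (h : ℕ) :
    opticalIndex (completeTree m (h + 1)) = ((m * geom m (h + 1) ^ 2 : ℕ) : ℕ∞) := by
  have : NeZero m := ⟨by omega⟩
  have hle : (m - 1) * geom m (h + 1) ^ 2 + geom m (h + 1) ≤ m * geom m (h + 1) ^ 2 := by
    obtain ⟨n, rfl⟩ : ∃ n, m = n + 1 := ⟨m - 1, by omega⟩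
    rw [Nat.add_sub_cancel, add_mul, one_mul]
    exact Nat.add_le_add_left (Nat.le_self_pow two_ne_zero _) _
  refine le_antisymm (opticalIndex_le (pairGraph_colorable_of_edge_coloring (by omega)
    (exists_edge_coloring_of_odd m) le_rfl ?_ ?_))
    (le_opticalIndex (by omega) (by omega) fun k hk => mul_sq_le_of_colorable hm (by omega) hk)
  · rwa [geom_mul_pow_eq (by omega)]
  · exact (star_count_le hm3 h).trans (by omega)

theorem opticalIndex_of_even (hm : Even m) (hm4 : 4 ≤ m) (h : ℕ) :
    opticalIndex (completeTree m (h + 1)) = ((geom m (h + 1) * m ^ (h + 1) : ℕ) : ℕ∞) := by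
  have hle : (m - 1) * geom m (h + 1) ^ 2 ≤ geom m (h + 1) * m ^ (h + 1) := by
    rw [geom_mul_pow_eq (by omega)]
    omega
  obtain ⟨n, rfl⟩ : ∃ n, m = n + 1 := ⟨m - 1, by omega⟩
  have hn : Odd n := by
    rw [Nat.even_add_one, Nat.not_even_iff_odd] at hm
    exact hm
  exact le_antisymm (opticalIndex_le (pairGraph_colorable_of_edge_coloring (by omega)
    (exists_edge_coloring_of_even hn) hle le_rfl
    ((star_count_le (by omega) h).trans hle)))
    (le_opticalIndex (by omega) (by omega) fun k hk => load_le_of_colorable (by omega) hk)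

theorem opticalIndex_binary_eq_load (h : ℕ)
    (hstar : geom 2 h * (geom 2 (h + 2) - (geom 2 h + 1)) +
      geom 2 h * (geom 2 (h + 2) - (2 * geom 2 h + 1)) ≤ geom 2 (h + 1) * 2 ^ (h + 1)) :
    opticalIndex (completeTree 2 (h + 1)) = ((geom 2 (h + 1) * 2 ^ (h + 1) : ℕ) : ℕ∞) := by
  refine le_antisymm (opticalIndex_le (pairGraph_colorable_of_edge_coloring le_rfl
    (exists_edge_coloring_of_even odd_one) ?_ le_rfl hstar))
    (le_opticalIndex (by omega) (by omega) fun k hk => load_le_of_colorable (by omega) hk)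
  rw [geom_mul_pow_eq (by omega)]
  omega

theorem star_count_le_of_colorable {k : ℕ} (hk : (pairGraph 2 (h + 2)).Colorable k) :
    geom 2 (h + 1) * (geom 2 (h + 3) - (geom 2 (h + 1) + 1)) +
      geom 2 (h + 1) * (geom 2 (h + 3) - (2 * geom 2 (h + 1) + 1)) ≤ k := by
  let z : TreeVertex 2 (h + 2) := ⟨[0], by simp⟩
  let c : TreeVertex 2 (h + 2) := ⟨[0, 0], by simp⟩
  let d : TreeVertex 2 (h + 2) := ⟨[0, 1], by simp⟩
  have hzc : IsChild z c := ⟨0, rfl⟩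
  have hzd : IsChild z d := ⟨1, rfl⟩
  have hcd : c ≠ d := by simp [c, d]
  have := card_star_le_of_colorable hk hcd hzc hzd ?_
  · rw [card_star hcd hzc hzd] at this
    exact this
  · rintro ⟨v, hv⟩ ⟨t, rfl⟩
    obtain _ | ⟨i, t⟩ := t
    · exact Or.inl rfl
    · right
      fin_cases i
      · exact Or.inl ⟨t, rfl⟩
      · exact Or.inr ⟨t, rfl⟩

theorem opticalIndex_binary_eq_star_count (h : ℕ) :
    ∃ w : ℕ, opticalIndex (completeTree 2 (h + 3)) = (w : ℕ∞) ∧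
      (w : ℤ) = 5 * 2 ^ (2 * (h + 3) - 2) - 3 * 2 ^ (h + 3) + 1 := by
  -- Writing `2 ^ h` as `x + 1` makes the sizes linear in `x` with natural coefficients, which
  -- disposes of the truncated subtractions.
  obtain ⟨x, hx⟩ : ∃ x, 2 ^ h = x + 1 := ⟨2 ^ h - 1, by have := Nat.one_le_two_pow (n := h); omega⟩
  have e2 : geom 2 (h + 2) = 4 * x + 3 := by
    have := geom_two (h + 2); rw [pow_add, hx] at this; omega
  have e3 : geom 2 (h + 3) = 8 * x + 7 := by
    have := geom_two (h + 3); rw [pow_add, hx] at this; omega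
  have e4 : geom 2 (h + 4) = 16 * x + 15 := by
    have := geom_two (h + 4); rw [pow_add, hx] at this; omega
  have e : geom 2 (h + 2) * (geom 2 (h + 4) - (geom 2 (h + 2) + 1)) +
      geom 2 (h + 2) * (geom 2 (h + 4) - (2 * geom 2 (h + 2) + 1)) =
      (4 * x + 3) * (20 * x + 19) := by
    rw [e2, e4, show 16 * x + 15 - (4 * x + 3 + 1) = 12 * x + 11 by omega,
      show 16 * x + 15 - (2 * (4 * x + 3) + 1) = 8 * x + 8 by omega]
    ring
  refine ⟨(4 * x + 3) * (20 * x + 19), le_antisymm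
    (opticalIndex_le (pairGraph_colorable_of_edge_coloring le_rfl
      (exists_edge_coloring_of_even odd_one) ?_ ?_ e.le))
    (le_opticalIndex (by omega) (by omega) fun k hk => e ▸ star_count_le_of_colorable hk), ?_⟩
  · rw [e3]
    nlinarith
  · rw [e3, show h + 2 + 1 = h + 3 from rfl, pow_add, hx]
    nlinarith
  · have hz : (2 : ℤ) ^ h = x + 1 := by exact_mod_cast hx
    rw [show 2 * (h + 3) - 2 = h + h + 4 by omega, pow_add, pow_add, pow_add _ h 3, hz]
    push_cast
    ring

theorem opticalIndex_unary (hh : 1 ≤ h) :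
    opticalIndex (completeTree 1 h) = (((h + 1) / 2 * ((h + 2) / 2) : ℕ) : ℕ∞) := by
  have hle : ∀ b, b ≤ h + 1 → b * (h + 1 - b) ≤ (h + 1) / 2 * ((h + 2) / 2) := by
    intro b hb
    have hs : h + 1 - (h + 1) / 2 = (h + 2) / 2 := by omega
    rw [← hs]
    rcases le_total b ((h + 1) / 2) with hb' | hb'
    · exact mul_sub_le_mul_sub hb' (by omega)
    · by_cases hbe : b = (h + 1) / 2
      · rw [hbe]
      · have := mul_sub_le_mul_sub (b := h + 1 - b) (s := (h + 1) / 2) (N := h + 1)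
          (by omega) (by omega)
        rwa [Nat.sub_sub_self hb, mul_comm] at this
  have hw : 0 < (h + 1) / 2 * ((h + 2) / 2) := Nat.mul_pos (by omega) (by omega)
  obtain ⟨n, rfl⟩ := Nat.exists_eq_add_of_le' hh
  refine le_antisymm (opticalIndex_le (pairGraph_colorable hw
    ⟨fun _ => ⟨0, hw⟩, fun q r hq => ?_⟩ (fun c _ => ?_) fun z c d _ hcd hzc hzd => ?_))
    (le_opticalIndex le_rfl hh fun k hk => ?_)
  · obtain ⟨i, j, -, -, hij, -⟩ := exists_inBranch_of_pairRank_eq_zero hq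
    omega
  · rw [card_cut, geom_one, geom_one]
    exact hle _ (by omega)
  · obtain ⟨t, ht⟩ := hzc
    obtain ⟨t', ht'⟩ := hzd
    exact absurd (Subtype.ext (by rw [ht, ht', Subsingleton.elim t t'])) hcd
  -- The middle edge of the path graph, which splits its `n + 2` vertices as evenly as possible.
  · have := card_cut_le_of_colorable hk ⟨List.replicate ((n + 1 + 1) / 2) 0, by simp; omega⟩
    rw [card_cut, geom_one, geom_one, List.length_replicate] at this
    rw [mul_comm]
    convert this using 2 <;> omega

theorem floor_half_mul_ceil_half (n : ℕ) :
    ⌊((n : ℚ) + 1) / 2⌋₊ * ⌈((n : ℚ) + 1) / 2⌉₊ = (n + 1) / 2 * ((n + 2) / 2) := by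
  have h1 : ⌊((n : ℚ) + 1) / 2⌋₊ = (n + 1) / 2 := by
    have := Nat.floor_div_eq_div (K := ℚ) (n + 1) 2
    push_cast at this
    exact this
  have h2 : ⌈((n : ℚ) + 1) / 2⌉₊ = (n + 2) / 2 := by
    rw [Nat.ceil_eq_iff (by omega)]
    rcases Nat.even_or_odd' n with ⟨k, rfl | rfl⟩
    · rw [show (2 * k + 2) / 2 = k + 1 by omega, Nat.add_sub_cancel]
      push_cast
      constructor <;> linarith
    · rw [show (2 * k + 1 + 2) / 2 = k + 1 by omega, Nat.add_sub_cancel]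
      push_cast
      constructor <;> linarith
  rw [h1, h2]

end OpticalIndex

theorem theorem1 :
    (∀ h : ℕ, 1 ≤ h →
      OpticalIndex.opticalIndex (OpticalIndex.completeTree 1 h)
        = ((⌊((h : ℚ) + 1) / 2⌋₊ * ⌈((h : ℚ) + 1) / 2⌉₊ : ℕ) : ℕ∞)) ∧
    (OpticalIndex.opticalIndex (OpticalIndex.completeTree 2 1) = 2 ∧
      OpticalIndex.opticalIndex (OpticalIndex.completeTree 2 2) = 12 ∧
      ∀ h : ℕ, 3 ≤ h →
        ∃ w : ℕ, OpticalIndex.opticalIndex (OpticalIndex.completeTree 2 h) = (w : ℕ∞) ∧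
          (w : ℤ) = 5 * 2 ^ (2 * h - 2) - 3 * 2 ^ h + 1) ∧
    (∀ m h : ℕ, Odd m → 3 ≤ m → 1 ≤ h →
      OpticalIndex.opticalIndex (OpticalIndex.completeTree m h)
        = ((m * (∑ i ∈ Finset.range h, m ^ i) ^ 2 : ℕ) : ℕ∞)) ∧
    (∀ m h : ℕ, Even m → 4 ≤ m → 1 ≤ h →
      OpticalIndex.opticalIndex (OpticalIndex.completeTree m h)
        = ((m ^ h * ∑ i ∈ Finset.range h, m ^ i : ℕ) : ℕ∞)) := by
  refine ⟨fun h hh => ?_, ⟨?_, ?_, fun h hh => ?_⟩, fun m h hm hm3 hh => ?_,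
    fun m h hm hm4 hh => ?_⟩
  · rw [OpticalIndex.floor_half_mul_ceil_half]
    exact OpticalIndex.opticalIndex_unary hh
  · exact OpticalIndex.opticalIndex_binary_eq_load 0 (by decide)
  · exact OpticalIndex.opticalIndex_binary_eq_load 1 (by decide)
  · obtain ⟨n, rfl⟩ := Nat.exists_eq_add_of_le' hh
    exact OpticalIndex.opticalIndex_binary_eq_star_count n
  · obtain ⟨n, rfl⟩ := Nat.exists_eq_add_of_le' hh
    exact OpticalIndex.opticalIndex_of_odd hm hm3 n
  · obtain ⟨n, rfl⟩ := Nat.exists_eq_add_of_le' hh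
    rw [mul_comm]
    exact OpticalIndex.opticalIndex_of_even hm hm4 n
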